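/- Let $K$ be a field of characteristic $0$ (for instance $\mathbb R$ or $\mathbb C$), let $r$ be an integer, and for $k\ge 1$, $0\le i\le s_k$ let $p_i(k), r_{k,i}\in K$ be arbitrary. Let $H$ be the Hopf algebra of rooted trees decorated by pairs $(k,i)$ (as an algebra, the commutative polynomial algebra over $K$ on the decorated rooted trees), and let $B_+^{k,i}:H\to H$ be the linear map that joins the roots of the trees of a forest to a new root decorated by $(k,i)$. Let $X=X(x)\in H[[x]]$ be the solution of the Dyson–Schwinger equation $$X=\mathbb I-\sum_{k\ge 1}\sum_{i=0}^{s_k}x^k\,p_i(k)\,B_+^{k,i}(XQ^k),\qquad Q=X^r .$$ Let the Mellin transforms be $F_{k,i}(\rho)$ with $\rho F_{k,i}(\rho)=r_{k,i}/(1-\rho)$, and let the renormalized Feynman rules $\phi_R:H\to K[L]$ be the algebra homomorphism determined by $$\phi_R\big(B_+^{k,i}(h)\big)(L)=\phi_R(h)(\partial_{-\rho})\Big[F_{k,i}(\rho)\big(e^{-L\rho}-1\big)\Big]\Big|_{\rho=0},\qquad \partial_{-\rho}=-\frac{\partial}{\partial\rho}.$$ Write the Green function as $G(x,L)=\phi_R(X)=1+\sum_{k\ge1}\gamma_k(x)L^k$.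 Then the anomalous dimension $\gamma_1$ has no constant term, $\gamma_1(x)=\sum_{n\ge1}\gamma_{1,n}x^n$, and for all $n\ge 1$ $$\gamma_{1,n}=p(n)+\sum_{j=1}^{n-1}(-rj-1)\,\gamma_{1,j}\,\gamma_{1,n-j},\qquad\text{where } p(k)=\sum_{i=0}^{s_k}r_{k,i}\,p_i(k).$$ -/

import Mathlib

namespace DysonSchwinger

/-- Planar rooted trees with vertices decorated by `D`. -/
inductive PlanarTree (D : Type) : Type
  | node (d : D) (children : List (PlanarTree D)) : PlanarTree D

/-- The equivalence relation generated by permuting the branches at the vertices of a planar tree.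
Its classes are the (non-planar) decorated rooted trees. -/
inductive PlanarTree.Iso {D : Type} : PlanarTree D → PlanarTree D → Prop
  | refl (t : PlanarTree D) : Iso t t
  | symm {t u : PlanarTree D} : Iso t u → Iso u t
  | trans {t u v : PlanarTree D} : Iso t u → Iso u v → Iso t v
  | perm (d : D) {l l' : List (PlanarTree D)} : l.Perm l' → Iso (.node d l) (.node d l')
  | branch (d : D) (l₁ l₂ : List (PlanarTree D)) {t t' : PlanarTree D} :
      Iso t t' → Iso (.node d (l₁ ++ t :: l₂)) (.node d (l₁ ++ t' :: l₂))

instance PlanarTree.setoid (D : Type) : Setoid (PlanarTree D) where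
  r := PlanarTree.Iso
  iseqv := ⟨.refl, .symm, .trans⟩

/-- Decorated (non-planar) rooted trees. -/
abbrev RootedTree (D : Type) : Type := Quotient (PlanarTree.setoid D)

/-- The rooted tree whose root is decorated by `d` and whose branches form the forest `f`. -/
noncomputable def RootedTree.graft {D : Type} (d : D) (f : Multiset (RootedTree D)) :
    RootedTree D :=
  Quotient.mk _ (PlanarTree.node d (f.toList.map Quotient.out))

theorem PlanarTree.iso_node_of_forall₂ {D : Type} (d : D) {l l' : List (PlanarTree D)}
    (h : List.Forall₂ PlanarTree.Iso l l') :
    PlanarTree.Iso (.node d l) (.node d l') := by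
  suffices H : ∀ l₀ : List (PlanarTree D),
      PlanarTree.Iso (.node d (l₀ ++ l)) (.node d (l₀ ++ l')) by simpa using H []
  induction h with
  | nil => intro l₀; exact .refl _
  | @cons a b l l' hab _ ih =>
    intro l₀
    refine (PlanarTree.Iso.branch d l₀ l hab).trans ?_
    simpa using ih (l₀ ++ [b])

/-- `RootedTree.graft` is what it should be on representatives. -/
theorem RootedTree.graft_mk {D : Type} (d : D) (l : List (PlanarTree D)) :
    RootedTree.graft d (Multiset.ofList (l.map (Quotient.mk (PlanarTree.setoid D)))) =
      Quotient.mk _ (PlanarTree.node d l) := by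
  apply Quotient.sound
  have h1 : (Multiset.ofList (l.map (Quotient.mk (PlanarTree.setoid D)))).toList.Perm
      (l.map (Quotient.mk (PlanarTree.setoid D))) := by
    rw [← Multiset.coe_eq_coe, Multiset.coe_toList]
  refine (PlanarTree.Iso.perm d (h1.map Quotient.out)).trans ?_
  apply PlanarTree.iso_node_of_forall₂
  rw [List.map_map, List.forall₂_map_left_iff]
  exact List.forall₂_same.2 fun t _ => Quotient.mk_out (s := PlanarTree.setoid D) t

/-- Decorations: the pair `(k, i)` stands for the `i`-th primitive at loop order `k`. -/
abbrev Decoration : Type := ℕ × ℕ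

/-- The (commutative algebra underlying the) Hopf algebra of decorated rooted trees: polynomials in
the rooted trees; its monomials are the forests. -/
abbrev TreeAlgebra (K : Type*) [CommSemiring K] : Type _ := MvPolynomial (RootedTree Decoration) K

/-- The grafting operator `B₊^{k,i}`: it joins the roots of all trees of a forest to a new root
decorated by `(k, i)`, extended linearly. -/
noncomputable def bPlus (K : Type*) [CommSemiring K] (k i : ℕ) : TreeAlgebra K →ₗ[K] TreeAlgebra K :=
  (MvPolynomial.basisMonomials (RootedTree Decoration) K).constr K fun f =>
    MvPolynomial.X (RootedTree.graft (k, i) (Finsupp.toMultiset f))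

section DSE

variable {K : Type*} [Field K]

/-- The combinatorial Dyson–Schwinger equation
`X = 𝕀 - ∑_{k ≥ 1} ∑_{i = 0}^{s k} x^k p_i(k) B₊^{k,i}(X Q^k)` with `Q = X^r`, in formal power
series in `x` over the algebra of decorated rooted trees. It is written out coefficient by
coefficient, `B₊^{k,i}` acting on the coefficients; in degree `n` only `k ≤ n` contribute. -/
def IsDSESolution (r : ℤ) (s : ℕ → ℕ) (p : ℕ → ℕ → K) (X : (PowerSeries (TreeAlgebra K))ˣ) :
    Prop :=
  ∀ n : ℕ, PowerSeries.coeff n (X : PowerSeries (TreeAlgebra K)) =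
    PowerSeries.coeff n (1 : PowerSeries (TreeAlgebra K)) -
      ∑ k ∈ Finset.Icc 1 n, ∑ i ∈ Finset.range (s k + 1),
        p i k • bPlus K k i
          (PowerSeries.coeff (n - k) ((X * (X ^ r) ^ k : (PowerSeries (TreeAlgebra K))ˣ) :
            PowerSeries (TreeAlgebra K)))

/-- Truncated powers only depend on truncations. -/
theorem coeff_mul_zpow_congr {R : Type*} [CommRing R] (r : ℤ) (k m : ℕ) (Y Y' : (PowerSeries R)ˣ)
    (h : ∀ j < m, PowerSeries.coeff j (Y : PowerSeries R) = PowerSeries.coeff j (Y' : PowerSeries R))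
    (j : ℕ) (hj : j < m) :
    PowerSeries.coeff j ((Y * (Y ^ r) ^ k : (PowerSeries R)ˣ) : PowerSeries R) =
      PowerSeries.coeff j ((Y' * (Y' ^ r) ^ k : (PowerSeries R)ˣ) : PowerSeries R) := by
  let q := Ideal.Quotient.mk (Ideal.span {(PowerSeries.X : PowerSeries R) ^ m})
  have key : ∀ a b : PowerSeries R, q a = q b ↔
      ∀ j < m, PowerSeries.coeff j a = PowerSeries.coeff j b := fun a b => by
    rw [Ideal.Quotient.eq, Ideal.mem_span_singleton, PowerSeries.X_pow_dvd_iff]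
    simp only [map_sub, sub_eq_zero]
  have hY : Units.map q.toMonoidHom Y = Units.map q.toMonoidHom Y' :=
    Units.ext ((key _ _).2 h)
  have hZ : Units.map q.toMonoidHom (Y * (Y ^ r) ^ k) =
      Units.map q.toMonoidHom (Y' * (Y' ^ r) ^ k) := by
    simp only [map_mul, map_pow, map_zpow, hY]
  exact (key _ _).1 (congrArg Units.val hZ) j hj

/-- The Dyson–Schwinger equation has exactly one solution. -/
theorem existsUnique_isDSESolution (r : ℤ) (s : ℕ → ℕ) (p : ℕ → ℕ → K) :
    ∃! X : (PowerSeries (TreeAlgebra K))ˣ, IsDSESolution r s p X := by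
  let S := PowerSeries (TreeAlgebra K)
  let t : Sˣ → S := fun Y => PowerSeries.mk fun n => PowerSeries.coeff n (1 : S) -
      ∑ k ∈ Finset.Icc 1 n, ∑ i ∈ Finset.range (s k + 1),
        p i k • bPlus K k i (PowerSeries.coeff (n - k) ((Y * (Y ^ r) ^ k : Sˣ) : S))
  have ht : ∀ Y, IsUnit (t Y) := fun Y => by
    rw [PowerSeries.isUnit_iff_constantCoeff, ← PowerSeries.coeff_zero_eq_constantCoeff_apply]
    simp [t]
  have agree : ∀ (m : ℕ) (Y Y' : Sˣ),
      (∀ j < m, PowerSeries.coeff j (Y : S) = PowerSeries.coeff j (Y' : S)) →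
      ∀ j < m + 1, PowerSeries.coeff j (t Y) = PowerSeries.coeff j (t Y') := by
    intro m Y Y' h j hj
    simp only [t, PowerSeries.coeff_mk]
    congr 1
    refine Finset.sum_congr rfl fun k hk => Finset.sum_congr rfl fun i _ => ?_
    rw [Finset.mem_Icc] at hk
    rw [coeff_mul_zpow_congr r k m Y Y' h (j - k) (by omega)]
  have sol : ∀ X : Sˣ, IsDSESolution r s p X ↔
      ∀ n, PowerSeries.coeff n (X : S) = PowerSeries.coeff n (t X) := fun X => by
    simp only [IsDSESolution, t, PowerSeries.coeff_mk, S]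
  obtain ⟨y, y_succ⟩ : ∃ y : ℕ → Sˣ, ∀ m, (y (m + 1)).val = t (y m) :=
    ⟨fun m => Nat.rec 1 (fun _ Y => (ht Y).unit) m, fun _ => rfl⟩
  have step : ∀ m, ∀ j < m, PowerSeries.coeff j (y m).val = PowerSeries.coeff j (y (m + 1)).val := by
    intro m
    induction m with
    | zero => intro j hj; omega
    | succ m ih => intro j hj; rw [y_succ, y_succ]; exact agree m _ _ ih j hj
  have stable : ∀ m l, m ≤ l → ∀ j < m,
      PowerSeries.coeff j (y m).val = PowerSeries.coeff j (y l).val := by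
    intro m l hml
    induction l, hml using Nat.le_induction with
    | base => intro j _; rfl
    | succ l hl ih => intro j hj; rw [ih j hj, step l j (by omega)]
  let x : S := PowerSeries.mk fun n => PowerSeries.coeff n (y (n + 1)).val
  have hx : ∀ m, ∀ j < m, PowerSeries.coeff j x = PowerSeries.coeff j (y m).val := by
    intro m j hj
    simp only [x, PowerSeries.coeff_mk]
    exact stable (j + 1) m hj j (by omega)
  have hu : IsUnit x := by
    rw [PowerSeries.isUnit_iff_constantCoeff, ← PowerSeries.coeff_zero_eq_constantCoeff_apply,
      hx (0 + 1) 0 (by omega), y_succ 0, PowerSeries.coeff_zero_eq_constantCoeff_apply,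
      ← PowerSeries.isUnit_iff_constantCoeff]
    exact ht _
  refine ⟨hu.unit, (sol _).2 fun n => ?_, fun X' hX' => ?_⟩
  · rw [IsUnit.unit_spec, hx (n + 1) n (by omega), y_succ]
    exact (agree n hu.unit (y n) (fun j hj => hx n j hj) n (by omega)).symm
  · have hX : ∀ m, ∀ j < m, PowerSeries.coeff j (X' : S) = PowerSeries.coeff j (y m).val := by
      intro m
      induction m with
      | zero => intro j hj; omega
      | succ m ih =>
        intro j hj
        rw [(sol X').1 hX' j, y_succ]
        exact agree m _ _ ih j hj
    refine Units.ext (PowerSeries.ext fun n => ?_)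
    rw [IsUnit.unit_spec, hx (n + 1) n (by omega), hX (n + 1) n (by omega)]

/-- The series `e^{-Lρ}` in `ρ`, with coefficients in `K[L]`. -/
noncomputable def expNegL (K : Type*) [Field K] : LaurentSeries (Polynomial K) :=
  HahnSeries.ofPowerSeries ℤ (Polynomial K)
    (PowerSeries.mk fun n => ((n.factorial : K)⁻¹) • (-Polynomial.X) ^ n)

/-- For a Mellin transform `F(ρ)`, the map taking `a(L)` to
`a(∂_{-ρ}) [F(ρ) (e^{-Lρ} - 1)] |_{ρ = 0}`, where `∂_{-ρ} = -∂/∂ρ`. -/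
noncomputable def insertion (F : LaurentSeries K) : Polynomial K →ₗ[K] Polynomial K where
  toFun a :=
    (Polynomial.aeval (-(LaurentSeries.derivative K) : Module.End K (LaurentSeries (Polynomial K))) a
      (F.map (Polynomial.C : K →+* Polynomial K) * (expNegL K - 1))).coeff 0
  map_add' a b := by simp
  map_smul' c a := by simp

mutual
/-- Renormalized Feynman rules on planar trees: a tree with root `(k, i)` is sent to the insertion
of the product of the values of its branches into the kernel with Mellin transform `F k i`. -/
noncomputable def planarRules (F : ℕ → ℕ → LaurentSeries K) :
    PlanarTree Decoration → Polynomial K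
  | .node d l => insertion (F d.1 d.2) (planarRulesList F l)

/-- The product of the Feynman rules over a list of planar trees. -/
noncomputable def planarRulesList (F : ℕ → ℕ → LaurentSeries K) :
    List (PlanarTree Decoration) → Polynomial K
  | [] => 1
  | t :: l => planarRules F t * planarRulesList F l
end

theorem planarRulesList_eq (F : ℕ → ℕ → LaurentSeries K) (l : List (PlanarTree Decoration)) :
    planarRulesList F l = (l.map (planarRules F)).prod := by
  induction l with
  | nil => simp [planarRulesList]
  | cons t l ih => simp [planarRulesList, ih]

theorem planarRules_iso (F : ℕ → ℕ → LaurentSeries K) {t u : PlanarTree Decoration}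
    (h : PlanarTree.Iso t u) : planarRules F t = planarRules F u := by
  induction h with
  | refl => rfl
  | symm _ ih => exact ih.symm
  | trans _ _ ih₁ ih₂ => exact ih₁.trans ih₂
  | perm d h =>
    simp only [planarRules, planarRulesList_eq]
    rw [(h.map _).prod_eq]
  | branch d l₁ l₂ _ ih =>
    simp only [planarRules, planarRulesList_eq, List.map_append, List.map_cons, ih]

/-- The renormalized Feynman rules `φ_R` for the Mellin transforms `F k i`: the algebra map from
decorated rooted trees to polynomials in `L` (see `feynmanRules_bPlus` for its defining property). -/
noncomputable def feynmanRules (F : ℕ → ℕ → LaurentSeries K) :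
    TreeAlgebra K →ₐ[K] Polynomial K :=
  MvPolynomial.aeval (Quotient.lift (planarRules F) fun _ _ h => planarRules_iso F h)

theorem feynmanRules_graft (F : ℕ → ℕ → LaurentSeries K) (k i : ℕ)
    (f : Multiset (RootedTree Decoration)) :
    feynmanRules F (MvPolynomial.X (RootedTree.graft (k, i) f)) =
      insertion (F k i) (f.map fun t => feynmanRules F (MvPolynomial.X t)).prod := by
  have hf : f = Multiset.ofList ((f.toList.map Quotient.out).map
      (Quotient.mk (PlanarTree.setoid Decoration))) := by
    rw [List.map_map]
    conv_lhs => rw [← Multiset.coe_toList f]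
    congr 1
    conv_lhs => rw [← List.map_id f.toList]
    exact List.map_congr_left fun t _ => (Quotient.out_eq t).symm
  rw [hf, RootedTree.graft_mk, Multiset.map_coe, Multiset.prod_coe]
  simp only [feynmanRules, MvPolynomial.aeval_X, Quotient.lift_mk, planarRules, planarRulesList_eq,
    List.map_map]
  rfl

/-- `φ_R(B₊^{k,i}(h))(L) = φ_R(h)(∂_{-ρ}) [F_{k,i}(ρ) (e^{-Lρ} - 1)] |_{ρ = 0}`. -/
theorem feynmanRules_bPlus (F : ℕ → ℕ → LaurentSeries K) (k i : ℕ) (h : TreeAlgebra K) :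
    feynmanRules F (bPlus K k i h) = insertion (F k i) (feynmanRules F h) := by
  suffices H : (feynmanRules F).toLinearMap ∘ₗ bPlus K k i =
      insertion (F k i) ∘ₗ (feynmanRules F).toLinearMap from LinearMap.congr_fun H h
  refine (MvPolynomial.basisMonomials (RootedTree Decoration) K).ext fun f => ?_
  simp only [LinearMap.comp_apply, bPlus, Module.Basis.constr_basis, AlgHom.toLinearMap_apply,
    feynmanRules_graft]
  congr 1
  rw [MvPolynomial.coe_basisMonomials]
  simp only [MvPolynomial.monomial_eq, MvPolynomial.C_1, one_mul, map_finsuppProd, map_pow]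
  rw [Finsupp.toMultiset_map, Finsupp.prod_toMultiset]
  exact Finsupp.prod_mapDomain_index (fun _ => pow_zero _) fun _ _ _ => pow_add _ _ _

/-- The Green function `G(x, L) = φ_R(X)`, a power series in `x` over `K[L]`. -/
noncomputable def greenFunction (F : ℕ → ℕ → LaurentSeries K)
    (X : (PowerSeries (TreeAlgebra K))ˣ) : PowerSeries (Polynomial K) :=
  PowerSeries.map (feynmanRules F : TreeAlgebra K →+* Polynomial K) X

/-- The series `γ_k(x)` in `G(x, L) = 1 + ∑_{k ≥ 1} γ_k(x) L^k`. -/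
noncomputable def gamma (F : ℕ → ℕ → LaurentSeries K) (X : (PowerSeries (TreeAlgebra K))ˣ) (k : ℕ) :
    PowerSeries K :=
  PowerSeries.mk fun n => (PowerSeries.coeff n (greenFunction F X)).coeff k

end DSE

end DysonSchwinger

namespace DysonSchwinger

-- Differentiating `e^{-Lρ}` in `L` multiplies it by `-ρ`, so `∂_L + ∂_L²` multiplies it by
-- `-ρ(1-ρ)`, which cancels the Mellin transform `c/(ρ(1-ρ))`. As `a(∂_{-ρ}) e^{-Lρ}` at `ρ = 0` is
-- `a(L)`, the operator undoes every insertion up to the factor `-c` (`derivative_insertion`). The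
-- Dyson–Schwinger equation thus becomes `G' + G'' = ∑ p(k) x^k G^{1+rk}` with `G(x,0) = 1`, primes
-- denoting `∂_L`.
--
-- Let `R = (∂_L - γ₁(1 + r x∂_x)) G`. This first-order operator sends `x^k G^{1+rk}` to `(1+rk) x^k
-- G^{rk} R` (`rgOperator_vertex`) and commutes with `∂_L`, so `R' + R'' = ∑ p(k)(1+rk) x^k G^{rk}
-- R`. Since `k ≥ 1` and `R` vanishes at `L = 0`, induction on the order in `x` gives `R = 0`
-- (`rgOperator_eq_zero`).
--
-- Differentiating `R = 0` once in `L` and setting `L = 0` gives `2γ₂ = γ₁(1 + r x∂_x)γ₁`. The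
-- differential equation at `L = 0` reads `γ₁ + 2γ₂ = ∑ p(k) x^k`. Eliminating `γ₂` and comparing
-- coefficients is the recursion.

-- Insertion into the kernel `c/(ρ(1-ρ))`

open Polynomial in
-- By Taylor's formula, the `n`-th derivative at `ρ = 0` is `n!` times the `n`-th coefficient; the
-- sign comes from `∂_{-ρ}`.
theorem insertion_X_pow {K : Type*} [Field K] (F : LaurentSeries K) (n : ℕ) :
    insertion F (X ^ n) = ((-1) ^ n * (n.factorial : K)) •
      (F.map (C : K →+* K[X]) * (expNegL K - 1)).coeff n := by
  simp only [insertion, LinearMap.coe_mk, AddHom.coe_mk, aeval_X_pow]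
  rw [← neg_one_smul K (LaurentSeries.derivative K), _root_.smul_pow, LinearMap.smul_apply,
    Module.End.pow_apply, LaurentSeries.derivative_iterate, HahnSeries.coeff_smul,
    HahnSeries.coeff_nsmul, Pi.smul_apply, LaurentSeries.hasseDeriv_coeff, zero_add,
    Ring.choose_natCast, Nat.choose_self, mul_smul, Nat.cast_smul_eq_nsmul]
  simp [Polynomial.smul_eq_C_mul]

/-- The Taylor coefficients of `ρ ↦ e^{-Lρ}`. -/
noncomputable def expCoeff (K : Type*) [Field K] (n : ℕ) : Polynomial K :=
  ((n.factorial : K)⁻¹) • (-Polynomial.X) ^ n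

theorem derivative_expCoeff_succ {K : Type*} [Field K] [CharZero K] (n : ℕ) :
    Polynomial.derivative (expCoeff K (n + 1)) = -expCoeff K n := by
  have h : ((n + 1).factorial : K)⁻¹ * ((n : K) + 1) = (n.factorial : K)⁻¹ := by
    have := Nat.cast_add_one_ne_zero (R := K) n
    have := Nat.cast_ne_zero (R := K).2 n.factorial_ne_zero
    rw [Nat.factorial_succ]
    push_cast
    field_simp
  rw [expCoeff, expCoeff, Polynomial.derivative_smul, Polynomial.derivative_pow_succ, ← h, mul_smul]
  simp [Polynomial.smul_eq_C_mul]

theorem coeff_zero_expCoeff_succ {K : Type*} [Field K] (n : ℕ) :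
    (expCoeff K (n + 1)).coeff 0 = 0 := by
  simp [expCoeff, Polynomial.coeff_zero_eq_eval_zero]

/-- The Taylor coefficients of `ρ ↦ (e^{-Lρ} - 1) / (ρ (1 - ρ))`. -/
noncomputable def kernelCoeff (K : Type*) [Field K] (n : ℕ) : Polynomial K :=
  ∑ m ∈ Finset.range (n + 1), expCoeff K (m + 1)

/-- Coefficientwise form of multiplication by `-ρ(1-ρ)`: `∂_L` shifts the exponential coefficients
down by one, and the two partial sums telescope. -/
theorem derivative_kernelCoeff {K : Type*} [Field K] [CharZero K] (n : ℕ) :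
    Polynomial.derivative (kernelCoeff K n) +
      Polynomial.derivative (Polynomial.derivative (kernelCoeff K n)) = -expCoeff K n := by
  induction n with
  | zero => simp [kernelCoeff, derivative_expCoeff_succ]; simp [expCoeff]
  | succ n ih =>
    rw [kernelCoeff, Finset.sum_range_succ, ← kernelCoeff]
    simp only [map_add, map_neg, derivative_expCoeff_succ]
    linear_combination ih

/-- The subtraction at `L = 0` makes the exponential factor divisible by `ρ`, which removes the pole
of `F`; the factor `1/(1-ρ)` produces the partial sums in `kernelCoeff`. -/
theorem mul_expNegL_sub_one {K : Type*} [Field K] {F : LaurentSeries K} {c : K}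
    (hF : (HahnSeries.single (1 : ℤ) (1 : K) : LaurentSeries K) * F =
      HahnSeries.C c / (1 - HahnSeries.single (1 : ℤ) (1 : K))) :
    F.map (Polynomial.C : K →+* Polynomial K) * (expNegL K - 1) =
      HahnSeries.ofPowerSeries ℤ (Polynomial K) (PowerSeries.mk fun n => c • kernelCoeff K n) := by
  let φ : PowerSeries (Polynomial K) →+* LaurentSeries (Polynomial K) :=
    HahnSeries.ofPowerSeries ℤ (Polynomial K)
  let t : LaurentSeries (Polynomial K) := HahnSeries.single (1 : ℤ) (1 : Polynomial K)
  have ht0 : t ≠ 0 := HahnSeries.single_ne_zero one_ne_zero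
  have hφX : φ PowerSeries.X = t := HahnSeries.ofPowerSeries_X
  have h1 : (1 - HahnSeries.single (1 : ℤ) (1 : K) : LaurentSeries K) ≠ 0 := fun h => by
    simpa using congrArg (fun f : LaurentSeries K => f.coeff 0) h
  rw [eq_div_iff h1] at hF
  have hF' : t * F.map (Polynomial.C : K →+* Polynomial K) * (1 - t) =
      φ (PowerSeries.C (Polynomial.C c)) := by
    have hmul : ∀ a b : LaurentSeries K, (a * b).map (Polynomial.C : K →+* Polynomial K) =
        a.map (Polynomial.C : K →+* Polynomial K) * b.map (Polynomial.C : K →+* Polynomial K) :=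
      fun a b => HahnSeries.map_mul ((Polynomial.C : K →+* Polynomial K) : K →ₙ+* Polynomial K)
    have hone : (1 - HahnSeries.single (1 : ℤ) (1 : K) : LaurentSeries K).map
        (Polynomial.C : K →+* Polynomial K) = 1 - t := by
      ext1
      ext1 n
      simp only [HahnSeries.map_coeff, HahnSeries.coeff_sub, HahnSeries.coeff_one,
        HahnSeries.coeff_single, t]
      split_ifs <;> simp
    have hsingle : (HahnSeries.single (1 : ℤ) (1 : K) : LaurentSeries K).map
        (Polynomial.C : K →+* Polynomial K) = t := by
      ext1
      ext1 n
      simp only [HahnSeries.map_coeff, HahnSeries.coeff_single, t]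
      split_ifs <;> simp
    have hC : (HahnSeries.C c : LaurentSeries K).map (Polynomial.C : K →+* Polynomial K) =
        φ (PowerSeries.C (Polynomial.C c)) := by
      rw [HahnSeries.ofPowerSeries_C]
      exact HahnSeries.map_C c _
    rw [← hone, ← hsingle, ← hmul, ← hmul, hF, hC]
  have hexp : expNegL K - 1 =
      φ (PowerSeries.X * PowerSeries.mk fun n => expCoeff K (n + 1)) := by
    rw [← map_one φ]
    change φ _ - φ 1 = _
    rw [← map_sub]
    congr 1
    ext1 n
    cases n with
    | zero => simp
    | succ n => simp [PowerSeries.coeff_succ_X_mul, expCoeff, PowerSeries.coeff_one]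
  have hk : (PowerSeries.mk fun n => c • kernelCoeff K n) * (1 - PowerSeries.X) =
      PowerSeries.C (Polynomial.C c) * PowerSeries.mk fun n => expCoeff K (n + 1) := by
    ext1 n
    rw [mul_sub, mul_one, map_sub, PowerSeries.coeff_C_mul]
    cases n with
    | zero => simp [kernelCoeff, Polynomial.smul_eq_C_mul]
    | succ n =>
      simp only [PowerSeries.coeff_succ_mul_X, PowerSeries.coeff_mk, kernelCoeff,
        Finset.sum_range_succ _ (n + 1), Polynomial.smul_eq_C_mul]
      ring
  have h2 : (1 - t) ≠ 0 := fun h => by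
    simpa [t] using congrArg (fun f : LaurentSeries (Polynomial K) => f.coeff 0) h
  -- Laurent series over `K[L]` form a domain, not a field, so the denominator `t(1-t)` is cleared
  -- by cancellation.
  refine mul_left_cancel₀ (mul_ne_zero ht0 h2) ?_
  change _ = _ * φ _
  have hk' := congrArg φ hk
  rw [map_mul, map_sub, map_one, map_mul, hφX] at hk'
  rw [hexp, map_mul, hφX]
  linear_combination (t * φ (PowerSeries.mk fun n => expCoeff K (n + 1))) * hF' - t * hk'

theorem insertion_X_pow_eq {K : Type*} [Field K] {F : LaurentSeries K} {c : K}
    (hF : (HahnSeries.single (1 : ℤ) (1 : K) : LaurentSeries K) * F =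
      HahnSeries.C c / (1 - HahnSeries.single (1 : ℤ) (1 : K))) (n : ℕ) :
    insertion F (Polynomial.X ^ n) =
      ((-1) ^ n * (n.factorial : K) * c) • kernelCoeff K n := by
  rw [insertion_X_pow, mul_expNegL_sub_one hF, HahnSeries.ofPowerSeries_apply_coeff,
    PowerSeries.coeff_mk, mul_smul _ c]

/-- `e^{-Lρ} - 1` vanishes at `L = 0`. This gives the boundary condition `G(x,0) = 1`. -/
theorem coeff_zero_insertion {K : Type*} [Field K] {F : LaurentSeries K} {c : K}
    (hF : (HahnSeries.single (1 : ℤ) (1 : K) : LaurentSeries K) * F =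
      HahnSeries.C c / (1 - HahnSeries.single (1 : ℤ) (1 : K))) (a : Polynomial K) :
    (insertion F a).coeff 0 = 0 := by
  induction a using Polynomial.induction_on' with
  | add a b ha hb => rw [map_add, Polynomial.coeff_add, ha, hb, add_zero]
  | monomial n a =>
    rw [← Polynomial.smul_X_eq_monomial, map_smul, insertion_X_pow_eq hF]
    simp [kernelCoeff, coeff_zero_expCoeff_succ]

/-- `(∂_L + ∂_L²)` inverts the insertion into `c / (ρ (1 - ρ))`, up to the factor `-c`. -/
theorem derivative_insertion {K : Type*} [Field K] [CharZero K] {F : LaurentSeries K} {c : K}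
    (hF : (HahnSeries.single (1 : ℤ) (1 : K) : LaurentSeries K) * F =
      HahnSeries.C c / (1 - HahnSeries.single (1 : ℤ) (1 : K))) (a : Polynomial K) :
    Polynomial.derivative (insertion F a) +
      Polynomial.derivative (Polynomial.derivative (insertion F a)) = -(c • a) := by
  induction a using Polynomial.induction_on' with
  | add a b ha hb =>
    simp only [map_add, smul_add]
    linear_combination ha + hb
  | monomial n a =>
    rw [← Polynomial.smul_X_eq_monomial, map_smul, insertion_X_pow_eq hF]
    simp only [Polynomial.derivative_smul, ← smul_add, derivative_kernelCoeff]
    -- The sign of `(-L)^n` cancels the one from `∂_{-ρ}`, and `n!` cancels the Taylor denominator.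
    have hX : (-Polynomial.X : Polynomial K) ^ n = (-1 : K) ^ n • Polynomial.X ^ n := by
      rw [neg_pow, Polynomial.smul_eq_C_mul]
      simp
    have hn := Nat.cast_ne_zero (R := K).2 n.factorial_ne_zero
    have hsign : ((-1 : K) ^ n) * (-1) ^ n = 1 := by rw [← mul_pow]; simp
    rw [expCoeff, hX, smul_neg, smul_neg, neg_inj]
    simp only [smul_smul]
    congr 1
    field_simp
    linear_combination a * c * hsign

/-- A polynomial without constant term is determined by `(∂_L + ∂_L²)`. -/
theorem eq_zero_of_derivative_add_derivative {K : Type*} [Field K] [CharZero K] {a : Polynomial K}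
    (h : Polynomial.derivative a + Polynomial.derivative (Polynomial.derivative a) = 0)
    (h0 : a.coeff 0 = 0) : a = 0 := by
  -- If `a'` is nonzero, then `a'' = -a'` contradicts the drop in degree under differentiation.
  have hd : Polynomial.derivative a = 0 := by
    by_contra hne
    have := Polynomial.degree_derivative_lt hne
    rw [← neg_eq_of_add_eq_zero_right h, Polynomial.degree_neg] at this
    exact lt_irrefl _ this
  rw [Polynomial.eq_C_of_derivative_eq_zero hd, h0, Polynomial.C_0]

-- Derivations of power series and integer powers of units

/-- The Euler operator `x d/dx`. -/
noncomputable def euler (A : Type*) [CommRing A] : PowerSeries A →+ PowerSeries A :=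
  (AddMonoidHom.mulLeft PowerSeries.X).comp (PowerSeries.derivative A : PowerSeries A →+ PowerSeries A)

theorem euler_apply {A : Type*} [CommRing A] (f : PowerSeries A) :
    euler A f = PowerSeries.X * PowerSeries.derivative A f :=
  rfl

theorem euler_mul {A : Type*} [CommRing A] (f g : PowerSeries A) :
    euler A (f * g) = f * euler A g + g * euler A f := by
  simp only [euler_apply, Derivation.leibniz, smul_eq_mul]
  ring

theorem coeff_euler {A : Type*} [CommRing A] (f : PowerSeries A) (n : ℕ) :
    PowerSeries.coeff n (euler A f) = n * PowerSeries.coeff n f := by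
  rw [euler_apply]
  cases n with
  | zero => simp
  | succ n =>
    rw [PowerSeries.coeff_succ_X_mul, PowerSeries.coeff_derivative]
    push_cast
    ring

theorem map_euler {A B : Type*} [CommRing A] [CommRing B] (φ : A →+* B) (f : PowerSeries A) :
    PowerSeries.map φ (euler A f) = euler B (PowerSeries.map φ f) := by
  ext1 n
  simp [coeff_euler]

/-- The power rule for integer powers of a unit. -/
theorem derivation_zpow_mul {S : Type*} [CommRing S] (δ : S →+ S)
    (hδ : ∀ a b, δ (a * b) = a * δ b + b * δ a) (u : Sˣ) (m : ℤ) :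
    δ ((u ^ m : Sˣ) : S) * u = m * ((u ^ m : Sˣ) : S) * δ u := by
  -- The logarithmic derivative `δv/v` is a homomorphism from units to the additive group, so
  -- integer exponents of either sign are handled at once.
  let dlog : Sˣ →* Multiplicative S :=
    { toFun := fun v => Multiplicative.ofAdd (δ v * ((v⁻¹ : Sˣ) : S))
      map_one' := by
        have := hδ 1 1
        simp only [mul_one, one_mul, left_eq_add] at this
        simp [this]
      map_mul' := fun v w => by
        rw [← ofAdd_add]
        congr 1
        simp only [Units.val_mul, hδ, mul_inv]
        linear_combination (δ w * (w⁻¹ : Sˣ) : S) * v.mul_inv + (δ v * (v⁻¹ : Sˣ) : S) * w.mul_inv }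
  have h : δ ((u ^ m : Sˣ) : S) * (((u ^ m)⁻¹ : Sˣ) : S) = m • (δ u * ((u⁻¹ : Sˣ) : S)) :=
    congrArg Multiplicative.toAdd (map_zpow dlog u m)
  rw [zsmul_eq_mul] at h
  linear_combination ((u ^ m : Sˣ) : S) * u * h - δ ((u ^ m : Sˣ) : S) * u * (u ^ m).mul_inv +
    m * ((u ^ m : Sˣ) : S) * δ u * u.mul_inv

-- The renormalization group equation

section RenormalizationGroup

variable {K : Type*} [Field K]

/-- The coefficientwise derivative `∂_L`. -/
noncomputable def dL (K : Type*) [Field K] :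
    PowerSeries (Polynomial K) →+ PowerSeries (Polynomial K) where
  toFun f := PowerSeries.mk fun n => Polynomial.derivative (PowerSeries.coeff n f)
  map_zero' := by ext1 n; simp
  map_add' f g := by ext1 n; simp

/-- Evaluation of the coefficients at `L = 0`. -/
noncomputable def atZero (K : Type*) [Field K] : PowerSeries (Polynomial K) →+* PowerSeries K :=
  PowerSeries.map Polynomial.constantCoeff

/-- Power series with constant coefficients, as series with coefficients in `K[L]`. -/
noncomputable def constL (K : Type*) [Field K] : PowerSeries K →+* PowerSeries (Polynomial K) :=
  PowerSeries.map Polynomial.C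

theorem coeff_dL (f : PowerSeries (Polynomial K)) (n : ℕ) :
    PowerSeries.coeff n (dL K f) = Polynomial.derivative (PowerSeries.coeff n f) :=
  PowerSeries.coeff_mk n fun n => Polynomial.derivative (PowerSeries.coeff n f)

theorem dL_mul (f g : PowerSeries (Polynomial K)) :
    dL K (f * g) = f * dL K g + g * dL K f := by
  ext1 n
  rw [mul_comm g, add_comm]
  simp only [coeff_dL, map_add, PowerSeries.coeff_mul, map_sum, Polynomial.derivative_mul,
    Finset.sum_add_distrib]

theorem coeff_atZero (f : PowerSeries (Polynomial K)) (n : ℕ) :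
    PowerSeries.coeff n (atZero K f) = (PowerSeries.coeff n f).coeff 0 := by
  simp [atZero]

theorem dL_constL (f : PowerSeries K) : dL K (constL K f) = 0 := by
  ext1 n
  simp [coeff_dL, constL]

theorem atZero_constL (f : PowerSeries K) : atZero K (constL K f) = f := by
  ext1 n
  simp [coeff_atZero, constL]

theorem dL_euler (f : PowerSeries (Polynomial K)) :
    dL K (euler (Polynomial K) f) = euler (Polynomial K) (dL K f) := by
  ext1 n
  simp [coeff_dL, coeff_euler]

theorem atZero_euler (f : PowerSeries (Polynomial K)) :
    atZero K (euler (Polynomial K) f) = euler K (atZero K f) := by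
  rw [atZero, map_euler]

theorem euler_X_pow (A : Type*) [CommRing A] (k : ℕ) :
    euler A ((PowerSeries.X : PowerSeries A) ^ k) =
      (k : PowerSeries A) * (PowerSeries.X : PowerSeries A) ^ k := by
  ext1 n
  rw [coeff_euler, ← map_natCast (PowerSeries.C : A →+* PowerSeries A) k, PowerSeries.coeff_C_mul,
    PowerSeries.coeff_X_pow]
  split_ifs with h <;> simp [h]

/-- The operator `∂_L - γ(x) (1 + r x d/dx)` of the renormalization group equation. -/
noncomputable def rgOperator (r : ℤ) (γ : PowerSeries K) (f : PowerSeries (Polynomial K)) :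
    PowerSeries (Polynomial K) :=
  dL K f - constL K γ * (f + (r : PowerSeries (Polynomial K)) * euler (Polynomial K) f)

theorem rgOperator_sub (r : ℤ) (γ : PowerSeries K) (f g : PowerSeries (Polynomial K)) :
    rgOperator r γ (f - g) = rgOperator r γ f - rgOperator r γ g := by
  simp only [rgOperator, map_sub]
  ring

theorem rgOperator_sum (r : ℤ) (γ : PowerSeries K) {ι : Type*} (t : Finset ι)
    (f : ι → PowerSeries (Polynomial K)) :
    rgOperator r γ (∑ i ∈ t, f i) = ∑ i ∈ t, rgOperator r γ (f i) := by
  simp only [rgOperator, map_sum, Finset.mul_sum, ← Finset.sum_add_distrib,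
    ← Finset.sum_sub_distrib]

theorem X_pow_dvd_rgOperator (r : ℤ) (γ : PowerSeries K) {m : ℕ} {f : PowerSeries (Polynomial K)}
    (h : PowerSeries.X ^ m ∣ f) : PowerSeries.X ^ m ∣ rgOperator r γ f := by
  rw [PowerSeries.X_pow_dvd_iff] at h
  refine dvd_sub ?_ (dvd_mul_of_dvd_right (dvd_add (PowerSeries.X_pow_dvd_iff.2 h)
    (dvd_mul_of_dvd_right ?_ _)) _) <;>
  · refine PowerSeries.X_pow_dvd_iff.2 fun n hn => ?_
    simp [coeff_dL, coeff_euler, h n hn]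

/-- `γ` and `r` do not depend on `L`, and `∂_L` commutes with `x∂_x`. -/
theorem dL_rgOperator (r : ℤ) (γ : PowerSeries K) (f : PowerSeries (Polynomial K)) :
    dL K (rgOperator r γ f) = rgOperator r γ (dL K f) := by
  have hr : dL K (r : PowerSeries (Polynomial K)) = 0 := by
    ext1 n
    rw [coeff_dL, ← map_intCast (PowerSeries.C : Polynomial K →+* _), PowerSeries.coeff_C]
    split_ifs <;> simp
  simp only [rgOperator, map_sub, map_add, dL_mul, dL_constL, dL_euler, hr,
    mul_zero, add_zero]

theorem rgOperator_add (r : ℤ) (γ : PowerSeries K) (f g : PowerSeries (Polynomial K)) :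
    rgOperator r γ (f + g) = rgOperator r γ f + rgOperator r γ g := by
  simp only [rgOperator, map_add]
  ring

/-- The vertices `c x^k g^{1+rk}` of the differential equation are mapped by the renormalization
group operator to multiples of `rgOperator r γ g`. -/
theorem rgOperator_vertex (r : ℤ) (γ : PowerSeries K) (g : (PowerSeries (Polynomial K))ˣ) (c : K)
    (k : ℕ) :
    rgOperator r γ (constL K (PowerSeries.C c) * (PowerSeries.X ^ k *
        ((g * (g ^ r) ^ k : (PowerSeries (Polynomial K))ˣ) : PowerSeries (Polynomial K)))) =
      PowerSeries.X ^ k * rgOperator r γ g * (constL K (PowerSeries.C c) * (1 + (r : PowerSeries (Polynomial K)) * (k : PowerSeries (Polynomial K))) *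
        (((g ^ r) ^ k : (PowerSeries (Polynomial K))ˣ) : PowerSeries (Polynomial K))) := by
  have hU : g * (g ^ r) ^ k = g ^ (1 + r * k) := by
    rw [zpow_add, zpow_one, zpow_mul, zpow_natCast]
  have hUg : ((g ^ (1 + r * k) : (PowerSeries (Polynomial K))ˣ) : PowerSeries (Polynomial K)) =
      g * (((g ^ r) ^ k : (PowerSeries (Polynomial K))ˣ) : PowerSeries (Polynomial K)) := by
    rw [← hU, Units.val_mul]
  have h1 := derivation_zpow_mul (dL K) dL_mul g (1 + r * k)
  have h2 := derivation_zpow_mul (euler (Polynomial K)) euler_mul g (1 + r * k)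
  have hX : dL K (PowerSeries.X ^ k) = 0 := by
    ext1 n
    rw [coeff_dL, PowerSeries.coeff_X_pow]
    split_ifs <;> simp
  have hc : euler (Polynomial K) (constL K (PowerSeries.C c)) = 0 := by
    ext1 n
    rw [coeff_euler]
    cases n <;> simp [constL, PowerSeries.coeff_C]
  rw [hU]
  -- Multiplying by `g` matches the form of the power rule. The undifferentiated term and `r x∂_x`
  -- on `x^k` together contribute `1 + rk`, exactly the exponent that the power rule brings down.
  refine g.isUnit.mul_right_cancel ?_
  simp only [rgOperator, dL_mul, euler_mul, dL_constL, hX, hc, euler_X_pow]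
  rw [hUg] at h1 h2 ⊢
  simp only [Int.cast_add, Int.cast_one, Int.cast_mul, Int.cast_natCast] at h1 h2
  linear_combination (constL K (PowerSeries.C c) * PowerSeries.X ^ k) * (h1 -
    constL K γ * r * h2)

/-- The renormalization group equation. -/
theorem rgOperator_eq_zero [CharZero K] (r : ℤ) (P : ℕ → K) (g : (PowerSeries (Polynomial K))ˣ)
    (hg : ∀ n, PowerSeries.coeff n (dL K g + dL K (dL K g)) =
      ∑ k ∈ Finset.Icc 1 n, P k • PowerSeries.coeff (n - k)
        ((g * (g ^ r) ^ k : (PowerSeries (Polynomial K))ˣ) : PowerSeries (Polynomial K)))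
    (hg0 : atZero K g = 1) :
    rgOperator r (atZero K (dL K g)) (g : PowerSeries (Polynomial K)) = 0 := by
  set γ := atZero K (dL K g) with hγ
  set R := rgOperator r γ (g : PowerSeries (Polynomial K)) with hR
  -- At `L = 0` the series `g` is `1`, so `R` becomes `γ - γ·1`.
  have hR0 : atZero K R = 0 := by
    rw [hR, rgOperator]
    simp only [map_sub, map_mul, map_add, atZero_constL, atZero_euler, hg0, ← hγ]
    have h1 : euler K 1 = 0 := by simpa using euler_X_pow K 0
    simp [h1]
  suffices H : ∀ N, PowerSeries.X ^ N ∣ R by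
    ext1 n
    exact PowerSeries.X_pow_dvd_iff.1 (H (n + 1)) n n.lt_succ_self
  intro N
  induction N with
  | zero => simp
  | succ N ih =>
    -- A finite truncation of the right-hand side suffices modulo `X^(N+1)`.
    let f : PowerSeries (Polynomial K) := ∑ k ∈ Finset.Icc 1 N, constL K (PowerSeries.C (P k)) *
      (PowerSeries.X ^ k *
        ((g * (g ^ r) ^ k : (PowerSeries (Polynomial K))ˣ) : PowerSeries (Polynomial K)))
    have hf : PowerSeries.X ^ (N + 1) ∣ (dL K g + dL K (dL K g)) - f := by
      refine PowerSeries.X_pow_dvd_iff.2 fun n hn => ?_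
      rw [map_sub, hg, sub_eq_zero, map_sum]
      refine Finset.sum_subset_zero_on_sdiff (Finset.Icc_subset_Icc_right (by omega))
        (fun k hk => ?_) (fun k hk => ?_)
      · have : ¬ k ≤ n := by simp only [Finset.mem_sdiff, Finset.mem_Icc] at hk; omega
        simp [constL, PowerSeries.coeff_X_pow_mul', this]
      · have : k ≤ n := (Finset.mem_Icc.1 hk).2
        simp only [constL, PowerSeries.map_C, PowerSeries.coeff_C_mul,
          PowerSeries.coeff_X_pow_mul', this, if_true, Polynomial.smul_eq_C_mul]
    have hDR : PowerSeries.X ^ (N + 1) ∣ dL K R + dL K (dL K R) := by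
      have h1 := X_pow_dvd_rgOperator r γ hf
      have h2 : PowerSeries.X ^ (N + 1) ∣ rgOperator r γ f := by
        rw [rgOperator_sum]
        refine Finset.dvd_sum fun k hk => ?_
        rw [rgOperator_vertex]
        refine Dvd.dvd.mul_right ?_ _
        -- The factor `X^k` with `k ≥ 1` supplies the additional power of `X`.
        rw [add_comm N, pow_add]
        exact mul_dvd_mul (pow_dvd_pow _ (Finset.mem_Icc.1 hk).1) ih
      rw [rgOperator_sub, rgOperator_add, ← dL_rgOperator, ← dL_rgOperator, ← dL_rgOperator] at h1
      simpa using dvd_add h1 h2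
    refine PowerSeries.X_pow_dvd_iff.2 fun n hn => eq_zero_of_derivative_add_derivative ?_ ?_
    · simpa [coeff_dL] using PowerSeries.X_pow_dvd_iff.1 hDR n hn
    · rw [← coeff_atZero, hR0, map_zero]

-- Elimination of `γ₂` at `L = 0`

/-- The recursion for the linear term in `L` of a solution of the differential equation. -/
theorem anomalousDimension_recursion [CharZero K] (r : ℤ) (P : ℕ → K)
    (g : (PowerSeries (Polynomial K))ˣ)
    (hg : ∀ n, PowerSeries.coeff n (dL K g + dL K (dL K g)) =
      ∑ k ∈ Finset.Icc 1 n, P k • PowerSeries.coeff (n - k)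
        ((g * (g ^ r) ^ k : (PowerSeries (Polynomial K))ˣ) : PowerSeries (Polynomial K)))
    (hg0 : atZero K g = 1) {n : ℕ} (hn : 1 ≤ n) :
    PowerSeries.coeff n (atZero K (dL K g)) + PowerSeries.coeff n
      ((atZero K (dL K g) + (r : PowerSeries K) * euler K (atZero K (dL K g))) * atZero K (dL K g)) = P n := by
  have hrg := congrArg (atZero K) (congrArg (dL K) (rgOperator_eq_zero r P g hg hg0))
  rw [dL_rgOperator, rgOperator] at hrg
  simp only [map_sub, map_mul, map_add, map_zero, map_intCast, atZero_constL, atZero_euler,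
    sub_eq_zero] at hrg
  rw [mul_comm, ← hrg, ← map_add, ← map_add, coeff_atZero, hg, Polynomial.finsetSum_coeff]
  -- All powers of `g` become `1` at `L = 0`, so only the summand `k = n` contributes to the
  -- coefficient of `x^n`.
  have hu : ∀ k : ℕ, atZero K ((g * (g ^ r) ^ k : (PowerSeries (Polynomial K))ˣ) :
      PowerSeries (Polynomial K)) = 1 := fun k => by
    have h1 : Units.map (atZero K : PowerSeries (Polynomial K) →* PowerSeries K) g = 1 :=
      Units.ext hg0
    have h2 : Units.map (atZero K : PowerSeries (Polynomial K) →* PowerSeries K)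
        (g * (g ^ r) ^ k) = 1 := by
      simp only [map_mul, map_pow, map_zpow, h1]
      simp
    exact congrArg Units.val h2
  simp only [Polynomial.coeff_smul, ← coeff_atZero, hu, PowerSeries.coeff_one, smul_eq_mul]
  rw [Finset.sum_eq_single_of_mem n (Finset.mem_Icc.2 ⟨hn, le_rfl⟩) fun k hk hkn => ?_]
  · simp
  · rw [if_neg, mul_zero]
    have := (Finset.mem_Icc.1 hk).2
    omega

end RenormalizationGroup

end DysonSchwinger


-- The Green function and the final recursion

theorem mainTheorem4 {K : Type*} [Field K] [CharZero K] (r : ℤ) (s : ℕ → ℕ) (p : ℕ → ℕ → K)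
    (F : ℕ → ℕ → LaurentSeries K) (res : ℕ → ℕ → K)
    (hF : ∀ k ≥ 1, ∀ i ≤ s k, (HahnSeries.single (1 : ℤ) (1 : K) : LaurentSeries K) * F k i =
      HahnSeries.C (res k i) / (1 - HahnSeries.single (1 : ℤ) (1 : K)))
    (X : (PowerSeries (DysonSchwinger.TreeAlgebra K))ˣ)
    (hX : DysonSchwinger.IsDSESolution r s p X) :
    PowerSeries.coeff 0 (DysonSchwinger.gamma F X 1) = 0 ∧
    ∀ n ≥ 1, PowerSeries.coeff n (DysonSchwinger.gamma F X 1) =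
      ∑ i ∈ Finset.range (s n + 1), res n i * p i n +
        ∑ j ∈ Finset.Ico 1 n, (-(r : K) * (j : K) - 1) *
          PowerSeries.coeff j (DysonSchwinger.gamma F X 1) *
          PowerSeries.coeff (n - j) (DysonSchwinger.gamma F X 1) := by
  let φ : PowerSeries (DysonSchwinger.TreeAlgebra K) →+* PowerSeries (Polynomial K) :=
    PowerSeries.map (DysonSchwinger.feynmanRules F : DysonSchwinger.TreeAlgebra K →+* Polynomial K)
  let g : (PowerSeries (Polynomial K))ˣ := Units.map (φ : PowerSeries (DysonSchwinger.TreeAlgebra K) →* PowerSeries (Polynomial K)) X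
  have hgX : (g : PowerSeries (Polynomial K)) = DysonSchwinger.greenFunction F X := rfl
  -- Applied coefficientwise, the Feynman rules are a ring homomorphism, so they preserve integer
  -- powers of units.
  have hU : ∀ k m, DysonSchwinger.feynmanRules F (PowerSeries.coeff m
      ((X * (X ^ r) ^ k : (PowerSeries (DysonSchwinger.TreeAlgebra K))ˣ) :
        PowerSeries (DysonSchwinger.TreeAlgebra K))) = PowerSeries.coeff m
      ((g * (g ^ r) ^ k : (PowerSeries (Polynomial K))ˣ) : PowerSeries (Polynomial K)) := by
    intro k m
    have : g * (g ^ r) ^ k = Units.map (φ : PowerSeries (DysonSchwinger.TreeAlgebra K) →* PowerSeries (Polynomial K)) (X * (X ^ r) ^ k) := by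
      simp only [map_mul, map_pow, map_zpow, g]
    rw [this]
    exact (PowerSeries.coeff_map _ _ _).symm
  have hG : ∀ n, PowerSeries.coeff n (g : PowerSeries (Polynomial K)) =
      PowerSeries.coeff n (1 : PowerSeries (Polynomial K)) -
        ∑ k ∈ Finset.Icc 1 n, ∑ i ∈ Finset.range (s k + 1), p i k •
          DysonSchwinger.insertion (F k i) (PowerSeries.coeff (n - k)
            ((g * (g ^ r) ^ k : (PowerSeries (Polynomial K))ˣ) : PowerSeries (Polynomial K))) := by
    intro n
    have h := congrArg (DysonSchwinger.feynmanRules F) (hX n)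
    simp only [map_sub, map_sum, map_smul, DysonSchwinger.feynmanRules_bPlus, hU,
      PowerSeries.coeff_one, apply_ite (DysonSchwinger.feynmanRules F), map_one, map_zero] at h
    rw [PowerSeries.coeff_one, ← h]
    exact PowerSeries.coeff_map (DysonSchwinger.feynmanRules F :
      DysonSchwinger.TreeAlgebra K →+* Polynomial K) n X.val
  have hg0 : DysonSchwinger.atZero K (g : PowerSeries (Polynomial K)) = 1 := by
    ext1 n
    rw [DysonSchwinger.coeff_atZero, hG, Polynomial.coeff_sub, Polynomial.finsetSum_coeff,
      Finset.sum_eq_zero fun k hk => ?_, sub_zero, PowerSeries.coeff_one, PowerSeries.coeff_one]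
    · split_ifs <;> simp
    · rw [Polynomial.finsetSum_coeff]
      refine Finset.sum_eq_zero fun i hi => ?_
      rw [Polynomial.coeff_smul, DysonSchwinger.coeff_zero_insertion (hF k (Finset.mem_Icc.1 hk).1 i
        (Nat.lt_succ_iff.1 (Finset.mem_range.1 hi))), smul_zero]
  have hg : ∀ n, PowerSeries.coeff n (DysonSchwinger.dL K g +
      DysonSchwinger.dL K (DysonSchwinger.dL K g)) = ∑ k ∈ Finset.Icc 1 n,
        (∑ i ∈ Finset.range (s k + 1), res k i * p i k) • PowerSeries.coeff (n - k)
          ((g * (g ^ r) ^ k : (PowerSeries (Polynomial K))ˣ) : PowerSeries (Polynomial K)) := by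
    intro n
    have h1 : Polynomial.derivative (PowerSeries.coeff n (1 : PowerSeries (Polynomial K))) = 0 := by
      rw [PowerSeries.coeff_one]
      split_ifs <;> simp
    rw [map_add, DysonSchwinger.coeff_dL, DysonSchwinger.coeff_dL, DysonSchwinger.coeff_dL, hG]
    simp only [map_sub, h1, zero_sub, map_neg, map_sum, Polynomial.derivative_smul, ← neg_add,
      ← Finset.sum_add_distrib, ← smul_add]
    rw [← Finset.sum_neg_distrib]
    refine Finset.sum_congr rfl fun k hk => ?_
    rw [← Finset.sum_neg_distrib, Finset.sum_smul]
    refine Finset.sum_congr rfl fun i hi => ?_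
    rw [DysonSchwinger.derivative_insertion (hF k (Finset.mem_Icc.1 hk).1 i
      (Nat.lt_succ_iff.1 (Finset.mem_range.1 hi))), smul_neg, neg_neg, smul_smul, mul_comm]
  have hγ : DysonSchwinger.gamma F X 1 = DysonSchwinger.atZero K (DysonSchwinger.dL K g) := by
    ext1 n
    simp [DysonSchwinger.gamma, DysonSchwinger.coeff_atZero, DysonSchwinger.coeff_dL,
      Polynomial.coeff_derivative, hgX]
  -- The `x^0` coefficient of `G` is the constant `1`, whose `L`-derivative is zero.
  have hγ0 : PowerSeries.coeff 0 (DysonSchwinger.gamma F X 1) = 0 := by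
    rw [hγ, DysonSchwinger.coeff_atZero, DysonSchwinger.coeff_dL, hG]
    simp
  refine ⟨hγ0, fun n hn => ?_⟩
  have hrec := DysonSchwinger.anomalousDimension_recursion r _ g hg hg0 hn
  rw [← hγ] at hrec
  generalize DysonSchwinger.gamma F X 1 = γ at hrec hγ0
  -- The end terms `j = 0` and `j = n` of the convolution vanish by `hγ0`; for the others, the
  -- factors `1 + rj` and `-rj - 1` cancel.
  rw [← hrec, PowerSeries.coeff_mul, Finset.Nat.sum_antidiagonal_eq_sum_range_succ_mk,
    Finset.sum_range_succ, Nat.sub_self, hγ0, mul_zero, add_zero, Finset.range_eq_Ico,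
    Finset.sum_eq_sum_Ico_succ_bot (by omega), add_assoc, left_eq_add]
  have hc : ∀ j, PowerSeries.coeff j (γ + (r : PowerSeries K) * DysonSchwinger.euler K γ) =
      (1 + (r : K) * (j : K)) * PowerSeries.coeff j γ := fun j => by
    rw [map_add, ← map_intCast (PowerSeries.C : K →+* PowerSeries K) r, PowerSeries.coeff_C_mul,
      DysonSchwinger.coeff_euler]
    ring
  simp only [hc, hγ0, mul_zero, zero_mul, zero_add, ← Finset.sum_add_distrib]
  exact Finset.sum_eq_zero fun j _ => by ring
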